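/- **Conventions.** Identify $\mathbb{R}/\mathbb{Z}$ with $[0,1)$. For $x\in[0,1)$ and $i\ge 1$ let $x_i\in\{0,1\}$ be the $i$-th binary digit of $x$, so that $x=\sum_{i\ge1}x_i2^{-i}$, where for a dyadic rational the expansion with finitely many digits $1$ is used. For $x,y\in[0,1)$, call $y$ a *subsequence of $x$ in terms of binary expansion* if there is an integer $N>0$ such that $y_j=0$ for all $1\le j\le N$ and, for all $i\ge1$, $y_{i+N}=1$ implies $x_i=1$. A set $E\subset\mathbb{R}/\mathbb{Z}$ is a *(binary) Erdős semigroup* if $E=\bigcup_{i\in\mathbb{N}}F_i$ for some sets $F_i\subset\mathbb{R}/\mathbb{Z}$ such that 1. each $F_i$ is closed in $\mathbb{R}/\mathbb{Z}$ and $\times2 \bmod 1$ invariant, i.e. $t\in F_i$ implies $2t\in F_i$; 2. there is a function $W:\mathbb{N}^2\to\mathbb{N}$ such that $F_i+F_j\subset F_{W(i,j)}$ for all $i,j$ (addition in $\mathbb{R}/\mathbb{Z}$); 3. for every $i$, if $x\in F_i$ and $y$ is a subsequence of $x$ in terms of binary expansion, then $y\in F_i$. **Theorem.** Let $E\subset\mathbb{R}/\mathbb{Z}$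 be an Erdős semigroup, viewed as a subset of $[0,1)$, with full Hausdorff dimension, $\dim_{\mathrm H}E=1$. Then there is $b>0$ such that $E$ is a basis of order $2$ for $(0,b]$, that is, there exists $x\in E$ with $$(0,b]\subset E+xE=\{e+xf: e,f\in E\},$$ where addition and multiplication are those of $\mathbb{R}$. -/

import Mathlib

open scoped Pointwise

/-- A subset of `ℝ/ℤ` viewed as a subset of `[0,1)`, every class being identified with its unique
representative in `[0,1)`. -/
def circleToUnit (E : Set UnitAddCircle) : Set ℝ :=
  {x : ℝ | x ∈ Set.Ico (0 : ℝ) 1 ∧ (x : UnitAddCircle) ∈ E}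

/-- `y` is a subsequence of `x` in terms of binary expansions, for `x, y ∈ [0,1)`: for some `N > 0`,
the first `N` binary digits of `y` vanish, and whenever the digit of `y` at position `i + N` is `1`,
the digit of `x` at position `i` is `1`.

`Real.digits x 2 i` is the binary digit of `x` of weight `2 ^ (-(i + 1))`, that is
`⌊x * 2 ^ (i + 1)⌋` modulo `2`; for dyadic rationals this is the expansion with finitely many
digits `1`. -/
def IsBinarySubsequence (y x : ℝ) : Prop :=
  ∃ N : ℕ, 0 < N ∧ (∀ j < N, Real.digits y 2 j = 0) ∧
    ∀ i : ℕ, Real.digits y 2 (i + N) = 1 → Real.digits x 2 i = 1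

/-- Binary Erdős semigroups in `ℝ/ℤ`. -/
def IsErdosSemigroup (E : Set UnitAddCircle) : Prop :=
  ∃ F : ℕ → Set UnitAddCircle,
    E = ⋃ i, F i ∧
    (∀ i, IsClosed (F i)) ∧
    (∀ i, ∀ t ∈ F i, 2 • t ∈ F i) ∧
    (∃ W : ℕ → ℕ → ℕ, ∀ i j, F i + F j ⊆ F (W i j)) ∧
    ∀ i, ∀ x ∈ circleToUnit (F i), ∀ y ∈ Set.Ico (0 : ℝ) 1,
      IsBinarySubsequence y x → y ∈ circleToUnit (F i)

/-- `E` is a basis of order `2` for `I`: `I ⊆ E + xE` for some `x ∈ E`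
(addition and multiplication of real numbers). -/
def IsBasisOfOrderTwo (E I : Set ℝ) : Prop :=
  ∃ x ∈ E, I ⊆ E + x • E

/-! By countable stability of dimension, one closed piece of `E` has dimension above 3/4; halving it
gives a compact `K` inside `E` and `[0, 1/2]`, still of dimension above 3/4.

A Falconer-type average produces `x ∈ K` with `K + x • K` of positive measure
(`exists_mem_volume_add_smul_pos`). Let μ be a Frostman measure of exponent s on `K`, with transform
φ. The image of μ × μ under (e, f) ↦ e + xf has transform φ(r)φ(xr). For r ~ 2^j, the μ-average over
x of |φ(xr)|² is O(2^(j(1-2s))), while the integral of |φ|² is O(2^(j(1-s))). The product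
2^(j(2-3s)) is summable once s > 2/3; s = 3/4 is a convenient choice. The argument runs on finite
measures at scale 2^(-n) (`exists_frostman_weights`, `exists_le_volume_cthickening`), and
compactness of `K` gives the limit point `x`.

By Steinhaus (`IsCompact.exists_Icc_subset_add`), the numbers (e₁ + e₂) + x(f₁ + f₂) fill an
interval. Digit shifts and addition keep both brackets in `E` after multiplication by (m+1)/2^N, as
long as no sum reaches 1. Such multiples of an interval fill some `(0, b]`
(`exists_Ioc_subset_dyadic_multiples`). -/

/-! ### Max-flow, min-cut on the binary tree -/

/-- A finite form of Frostman's lemma on the binary tree: a finite set of leaves carries weights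
whose mass below any vertex is at most the prescribed capacity, and whose total mass is at least
the capacity of some cover of the leaves by vertices. -/
theorem exists_binaryTree_weights (τ : ℕ → ℝ) (hτ : ∀ j, 0 < τ j) (P : Finset ℕ) (k : ℕ) :
    ∀ v : ℕ, ∃ w : ℕ → ℝ, (∀ p, 0 ≤ w p) ∧ (∀ p, w p ≠ 0 → p / 2 ^ k = v) ∧
      (∀ j ≤ k, ∀ u, ∑ p ∈ P with p / 2 ^ j = u, w p ≤ τ j) ∧
      ∃ T : Finset (ℕ × ℕ), (∀ c ∈ T, c.1 ≤ k) ∧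
        (∀ p ∈ P, p / 2 ^ k = v → ∃ c ∈ T, p / 2 ^ c.1 = c.2) ∧
        ∑ c ∈ T, τ c.1 ≤ ∑ p ∈ P, w p := by
  induction k with
  | zero =>
    intro v
    refine ⟨fun p => if p = v then τ 0 else 0, ?_, ?_, ?_, ?_⟩
    · intro p
      dsimp only
      split_ifs
      exacts [(hτ 0).le, le_rfl]
    · intro p hp
      simpa using (ite_ne_right_iff.1 hp).1
    · intro j hj u
      obtain rfl : j = 0 := by omega
      rw [Finset.sum_ite_eq']
      split_ifs
      exacts [le_rfl, (hτ 0).le]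
    · by_cases hv : v ∈ P
      · refine ⟨{(0, v)}, by simp, by simp, ?_⟩
        simp [hv]
      · refine ⟨∅, by simp, ?_, ?_⟩
        · intro p hp hpv
          simp at hpv
          exact absurd (hpv ▸ hp) hv
        · simp [hv]
  | succ k ih =>
    intro v
    obtain ⟨w₀, h0, hs0, hb0, T₀, hT0, hc0, ht0⟩ := ih (2 * v)
    obtain ⟨w₁, h1, hs1, hb1, T₁, hT1, hc1, ht1⟩ := ih (2 * v + 1)
    have hdiv : ∀ p : ℕ, p / 2 ^ (k + 1) = p / 2 ^ k / 2 := fun p => by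
      rw [pow_succ, Nat.div_div_eq_div_mul]
    have hsupp : ∀ p, w₀ p + w₁ p ≠ 0 → p / 2 ^ (k + 1) = v := by
      intro p hp
      rw [hdiv]
      by_cases h : w₀ p = 0
      · have := hs1 p (by simpa [h] using hp)
        omega
      · have := hs0 p h
        omega
    -- A vertex of height at most `k` lies under at most one of the two children, so at most one of
    -- `w₀`, `w₁` is nonzero below it.
    have hbound : ∀ j ≤ k, ∀ u, ∑ p ∈ P with p / 2 ^ j = u, (w₀ p + w₁ p) ≤ τ j := by
      intro j hj u
      have hjk : ∀ p : ℕ, p / 2 ^ k = p / 2 ^ j / 2 ^ (k - j) := fun p => by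
        rw [Nat.div_div_eq_div_mul, ← pow_add, Nat.add_sub_cancel' hj]
      by_cases hu : u / 2 ^ (k - j) = 2 * v
      · refine le_of_eq_of_le (Finset.sum_congr rfl fun p hp => ?_) (hb0 j hj u)
        have hp' := (Finset.mem_filter.1 hp).2
        have : w₁ p = 0 := by
          by_contra h
          have := hs1 p h
          rw [hjk, hp', hu] at this
          omega
        simp [this]
      · refine le_of_eq_of_le (Finset.sum_congr rfl fun p hp => ?_) (hb1 j hj u)
        have hp' := (Finset.mem_filter.1 hp).2
        have : w₀ p = 0 := by
          by_contra h
          have := hs0 p h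
          rw [hjk, hp'] at this
          exact hu this
        simp [this]
    have hnn : ∀ p, 0 ≤ w₀ p + w₁ p := fun p => add_nonneg (h0 p) (h1 p)
    have hsub : ∀ j u, ∑ p ∈ P with p / 2 ^ j = u, (w₀ p + w₁ p) ≤ ∑ p ∈ P, (w₀ p + w₁ p) :=
      fun j u => Finset.sum_le_sum_of_subset_of_nonneg (Finset.filter_subset _ _)
        fun p _ _ => hnn p
    -- If the glued weights respect the capacity of the new root, the two covers are united.
    -- Otherwise the weights are scaled down to saturate the root, which alone is then the cover.
    by_cases htot : ∑ p ∈ P, (w₀ p + w₁ p) ≤ τ (k + 1)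
    · refine ⟨fun p => w₀ p + w₁ p, hnn, hsupp, ?_, T₀ ∪ T₁, ?_, ?_, ?_⟩
      · intro j hj u
        rcases Nat.lt_or_ge k j with h | h
        · obtain rfl : j = k + 1 := by omega
          exact (hsub _ _).trans htot
        · exact hbound j h u
      · intro c hc
        rcases Finset.mem_union.1 hc with h | h
        · exact (hT0 c h).trans (Nat.le_succ k)
        · exact (hT1 c h).trans (Nat.le_succ k)
      · intro p hp hpv
        rw [hdiv] at hpv
        rcases (by omega : p / 2 ^ k = 2 * v ∨ p / 2 ^ k = 2 * v + 1) with h | h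
        · obtain ⟨c, hc, h⟩ := hc0 p hp h
          exact ⟨c, Finset.mem_union_left _ hc, h⟩
        · obtain ⟨c, hc, h⟩ := hc1 p hp h
          exact ⟨c, Finset.mem_union_right _ hc, h⟩
      · rw [Finset.sum_add_distrib]
        have := Finset.sum_union_inter (s₁ := T₀) (s₂ := T₁) (f := fun c => τ c.1)
        have h' : 0 ≤ ∑ c ∈ T₀ ∩ T₁, τ c.1 := Finset.sum_nonneg fun c _ => (hτ _).le
        linarith
    · push Not at htot
      set W := ∑ p ∈ P, (w₀ p + w₁ p) with hW
      have hWpos : 0 < W := (hτ _).trans htot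
      have hl1 : τ (k + 1) / W ≤ 1 := (div_le_one hWpos).2 htot.le
      have hl0 : 0 ≤ τ (k + 1) / W := (div_pos (hτ _) hWpos).le
      refine ⟨fun p => τ (k + 1) / W * (w₀ p + w₁ p), fun p => mul_nonneg hl0 (hnn p), ?_, ?_,
        {(k + 1, v)}, by simp, by simp, ?_⟩
      · intro p hp
        exact hsupp p fun h => hp (by simp [h])
      · intro j hj u
        rw [← Finset.mul_sum]
        rcases Nat.lt_or_ge k j with h | h
        · obtain rfl : j = k + 1 := by omega
          calc _ ≤ τ (k + 1) / W * W := mul_le_mul_of_nonneg_left (hsub _ _) hl0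
            _ = _ := div_mul_cancel₀ _ hWpos.ne'
        · exact (mul_le_of_le_one_left (Finset.sum_nonneg fun p _ => hnn p) hl1).trans
            (hbound j h u)
      · rw [← Finset.mul_sum, ← hW, div_mul_cancel₀ _ hWpos.ne']
        simp

/-! ### The Fejér kernel -/

section FejerKernel

/-- The Fejér kernel, as the cosine transform of a tent function. -/
noncomputable def fejerKernel (L z : ℝ) : ℝ := ∫ r in (0 : ℝ)..L, (1 - r / L) * Real.cos (r * z)

theorem fejerKernel_zero {L : ℝ} (hL : 0 < L) : fejerKernel L 0 = L / 2 := by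
  simp only [fejerKernel, mul_zero, Real.cos_zero, mul_one]
  rw [intervalIntegral.integral_sub (by simp) (by
    apply Continuous.intervalIntegrable; fun_prop), intervalIntegral.integral_div]
  simp
  field_simp
  ring

theorem fejerKernel_of_ne_zero {L z : ℝ} (hL : 0 < L) (hz : z ≠ 0) :
    fejerKernel L z = (1 - Real.cos (L * z)) / (L * z ^ 2) := by
  have hd : ∀ r ∈ Set.uIcc 0 L, HasDerivAt
      (fun r => (1 - r / L) * (Real.sin (r * z) / z) - Real.cos (r * z) / (L * z ^ 2))
      ((1 - r / L) * Real.cos (r * z)) r := by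
    intro r _
    have h1 : HasDerivAt (fun r : ℝ => r * z) z r := by simpa using (hasDerivAt_id r).mul_const z
    have h2 : HasDerivAt (fun r : ℝ => 1 - r / L) (-(1 / L)) r := by
      simpa using ((hasDerivAt_id r).div_const L).const_sub 1
    have h := (h2.mul (h1.sin.div_const z)).sub (h1.cos.div_const (L * z ^ 2))
    refine h.congr_deriv ?_
    field_simp
    ring
  rw [fejerKernel, intervalIntegral.integral_eq_sub_of_hasDerivAt hd
    (by apply Continuous.intervalIntegrable; fun_prop)]
  simp
  field_simp
  ring

theorem fejerKernel_nonneg {L : ℝ} (hL : 0 < L) (z : ℝ) : 0 ≤ fejerKernel L z := by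
  rcases eq_or_ne z 0 with rfl | hz
  · rw [fejerKernel_zero hL]; positivity
  · rw [fejerKernel_of_ne_zero hL hz]
    have := Real.cos_le_one (L * z)
    exact div_nonneg (by linarith) (by positivity)

/-- With v = Lz, combine 1 - cos v ≤ v²/2 for v² ≤ 1 with 1 - cos v ≤ 2 for v² ≥ 1. -/
theorem fejerKernel_le {L : ℝ} (hL : 0 < L) (z : ℝ) :
    fejerKernel L z ≤ 4 * L / (1 + (L * z) ^ 2) := by
  rcases eq_or_ne z 0 with rfl | hz
  · rw [fejerKernel_zero hL]; simp; linarith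
  · rw [fejerKernel_of_ne_zero hL hz, div_le_div_iff₀ (by positivity) (by positivity)]
    set v := L * z with hv
    have h1 := Real.one_sub_sq_div_two_le_cos (x := v)
    have h2 := Real.neg_one_le_cos v
    have h3 : 4 * L * (L * z ^ 2) = 4 * v ^ 2 := by rw [hv]; ring
    rw [h3]
    rcases le_total (v ^ 2) 1 with h | h
    · nlinarith [sq_nonneg v]
    · nlinarith [sq_nonneg v]

/-- This lets the kernel dominate the indicator of a collision at scale 1/L. -/
theorem le_fejerKernel {L z : ℝ} (hL : 0 < L) (hz : |L * z| ≤ 1) : L / 4 ≤ fejerKernel L z := by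
  rcases eq_or_ne z 0 with rfl | h
  · rw [fejerKernel_zero hL]; linarith
  · rw [fejerKernel_of_ne_zero hL h, div_le_div_iff₀ (by positivity) (by positivity)]
    set v := L * z with hv
    have h1 := (abs_le.1 (Real.cos_bound hz)).2
    have h3 : L * (L * z ^ 2) = v ^ 2 := by rw [hv]; ring
    have h4 : |v| ^ 4 ≤ v ^ 2 := by
      have : |v| ^ 4 = v ^ 2 * v ^ 2 := by
        rw [show |v| ^ 4 = |v| ^ 2 * |v| ^ 2 by ring, sq_abs]
      have h5 : v ^ 2 ≤ 1 := by rw [← sq_abs]; exact pow_le_one₀ (abs_nonneg _) hz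
      rw [this]
      exact mul_le_of_le_one_left (sq_nonneg v) h5
    rw [h3]
    nlinarith [sq_nonneg v]

end FejerKernel

/-! ### Exponential sums and the energy estimate -/

section ExponentialSums

variable {ι : Type*} [Fintype ι]

/-- The Fourier transform of the discrete measure with masses `a i` at the points `y i`. -/
noncomputable def expSum (a y : ι → ℝ) (r : ℝ) : ℂ :=
  ∑ i, (a i : ℂ) * Complex.exp ((r * y i : ℝ) * Complex.I)

theorem continuous_expSum (a y : ι → ℝ) : Continuous (expSum a y) := by
  unfold expSum
  fun_prop

theorem norm_sq_expSum (a y : ι → ℝ) (r : ℝ) :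
    ‖expSum a y r‖ ^ 2 = ∑ i, ∑ k, a i * a k * Real.cos (r * (y i - y k)) := by
  have hre : (expSum a y r).re = ∑ i, a i * Real.cos (r * y i) := by
    simp only [expSum, Complex.re_sum, Complex.re_ofReal_mul, Complex.exp_ofReal_mul_I_re]
  have him : (expSum a y r).im = ∑ i, a i * Real.sin (r * y i) := by
    simp only [expSum, Complex.im_sum, Complex.im_ofReal_mul, Complex.exp_ofReal_mul_I_im]
  rw [Complex.sq_norm, Complex.normSq_apply, hre, him, Finset.sum_mul_sum, Finset.sum_mul_sum,
    ← Finset.sum_add_distrib]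
  refine Finset.sum_congr rfl fun i _ => ?_
  rw [← Finset.sum_add_distrib]
  refine Finset.sum_congr rfl fun k _ => ?_
  rw [mul_sub, Real.cos_sub]
  ring

theorem norm_expSum_le (a y : ι → ℝ) (r : ℝ) : ‖expSum a y r‖ ≤ ∑ i, |a i| := by
  refine (norm_sum_le _ _).trans (Finset.sum_le_sum fun i _ => ?_)
  rw [norm_mul, Complex.norm_exp_ofReal_mul_I, mul_one, Complex.norm_real, Real.norm_eq_abs]

/-- The image measure is the convolution of the measure with its dilate by `x`, so its transform
factors. -/
theorem expSum_prod (a y : ι → ℝ) (x r : ℝ) :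
    expSum (fun α : ι × ι => a α.1 * a α.2) (fun α => y α.1 + x * y α.2) r =
      expSum a y r * expSum a y (x * r) := by
  simp only [expSum, Fintype.sum_prod_type, Finset.sum_mul_sum]
  refine Finset.sum_congr rfl fun i _ => Finset.sum_congr rfl fun k _ => ?_
  rw [mul_mul_mul_comm, ← Complex.exp_add]
  push_cast
  congr 2
  ring

/-- The tent is used because it yields a nonnegative kernel; a sharp cutoff would give the
sign-changing sin(Lz)/z. -/
theorem integral_tent_mul_norm_sq_expSum (a y : ι → ℝ) (L : ℝ) :
    ∫ r in (0 : ℝ)..L, (1 - r / L) * ‖expSum a y r‖ ^ 2 =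
      ∑ i, ∑ k, a i * a k * fejerKernel L (y i - y k) := by
  simp only [norm_sq_expSum, Finset.mul_sum, fejerKernel]
  rw [intervalIntegral.integral_finsetSum fun i _ => by
    apply Continuous.intervalIntegrable; fun_prop]
  refine Finset.sum_congr rfl fun i _ => ?_
  rw [intervalIntegral.integral_finsetSum fun i _ => by
    apply Continuous.intervalIntegrable; fun_prop]
  refine Finset.sum_congr rfl fun k _ => ?_
  rw [← intervalIntegral.integral_const_mul]
  congr 1
  ext r
  ring

theorem summable_inv_one_add_int_sq : Summable fun l : ℤ => 1 / (1 + (l : ℝ) ^ 2) := by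
  refine Summable.of_norm_bounded_eventually (g := fun l : ℤ => 1 / (l : ℝ) ^ 2)
    (Real.summable_one_div_int_pow.2 one_lt_two) ?_
  filter_upwards [(Set.finite_singleton (0 : ℤ)).compl_mem_cofinite] with l hl
  have hl' : (l : ℝ) ≠ 0 := by exact_mod_cast hl
  rw [Real.norm_of_nonneg (by positivity)]
  exact one_div_le_one_div_of_le (by positivity) (by linarith)

/-- The sum of `1 / (1 + l ^ 2)` over the integers. -/
noncomputable def cauchySum : ℝ := ∑' l : ℤ, 1 / (1 + (l : ℝ) ^ 2)

theorem cauchySum_nonneg : 0 ≤ cauchySum := tsum_nonneg fun l => by positivity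

/-- Sort the points into cells of length 1/T counted from `t`, each of mass at most `B`. The factor
3 comes from 1 + l² ≤ 3(1 + u²) for l = ⌊u⌋. -/
theorem sum_mul_cauchyKernel_le {w y : ι → ℝ} (hw : ∀ i, 0 ≤ w i) {T B : ℝ} (hT : 0 < T)
    (hB : ∀ a : ℝ, ∑ i with y i ∈ Set.Ico a (a + T⁻¹), w i ≤ B) (t : ℝ) :
    ∑ i, w i * (1 / (1 + (T * (y i - t)) ^ 2)) ≤ 3 * cauchySum * B := by
  classical
  have hB0 : 0 ≤ B := (Finset.sum_nonneg fun i _ => hw i).trans (hB 0)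
  set fl : ι → ℤ := fun i => ⌊T * (y i - t)⌋ with hfl
  have h1 : ∀ i, w i * (1 / (1 + (T * (y i - t)) ^ 2)) ≤ 3 * (1 / (1 + (fl i : ℝ) ^ 2) * w i) := by
    intro i
    have ha := Int.floor_le (T * (y i - t))
    have hb := Int.lt_floor_add_one (T * (y i - t))
    have : 1 / (1 + (T * (y i - t)) ^ 2) ≤ 3 * (1 / (1 + (fl i : ℝ) ^ 2)) := by
      rw [mul_one_div, div_le_div_iff₀ (by positivity) (by positivity)]
      simp only [hfl]
      generalize (⌊T * (y i - t)⌋ : ℝ) = l at ha hb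
      generalize T * (y i - t) = u at ha hb
      have : (u - l) ^ 2 ≤ 1 := pow_le_one₀ (by linarith) (by linarith)
      nlinarith [sq_nonneg (u + (u - l)), sq_nonneg u]
    nlinarith [mul_le_mul_of_nonneg_left this (hw i)]
  refine (Finset.sum_le_sum fun i _ => h1 i).trans ?_
  rw [← Finset.mul_sum, mul_assoc]
  refine mul_le_mul_of_nonneg_left ?_ (by norm_num)
  rw [← Finset.sum_fiberwise_of_maps_to (t := Finset.univ.image fl) (g := fl)
    fun i hi => Finset.mem_image_of_mem _ hi]
  calc _ ≤ ∑ l ∈ Finset.univ.image fl, 1 / (1 + (l : ℝ) ^ 2) * B := by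
        refine Finset.sum_le_sum fun l _ => ?_
        rw [Finset.sum_congr rfl (g := fun i => 1 / (1 + (l : ℝ) ^ 2) * w i) fun i hi => by
          rw [(Finset.mem_filter.1 hi).2], ← Finset.mul_sum]
        refine mul_le_mul_of_nonneg_left ?_ (by positivity)
        refine le_trans (Finset.sum_le_sum_of_subset_of_nonneg ?_ fun i _ _ => hw i)
          (hB (t + l / T))
        intro i hi
        simp only [Finset.mem_filter, Finset.mem_univ, true_and, hfl, Int.floor_eq_iff] at hi ⊢
        rw [Set.mem_Ico]
        constructor
        · have : (l : ℝ) / T ≤ y i - t := by rw [div_le_iff₀ hT]; linarith [hi.1]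
          linarith
        · have : y i - t < (l + 1) / T := by rw [lt_div_iff₀ hT]; linarith [hi.2]
          rw [add_div, one_div] at this
          linarith
    _ ≤ cauchySum * B := by
        rw [← Finset.sum_mul]
        exact mul_le_mul_of_nonneg_right
          (summable_inv_one_add_int_sq.sum_le_tsum _ fun l _ => by positivity) hB0

/-- The energy estimate: the mass of a measure on short intervals controls the mean square of its
Fourier transform over long ones. -/
theorem integral_norm_sq_expSum_le {w y a : ι → ℝ} (ha : ∀ i, |a i| ≤ w i)
    (hw1 : ∑ i, w i = 1) {T B : ℝ} (hT : 0 < T)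
    (hB : ∀ a : ℝ, ∑ i with y i ∈ Set.Ico a (a + T⁻¹), w i ≤ B) :
    ∫ r in (0 : ℝ)..T, ‖expSum a y r‖ ^ 2 ≤ 48 * cauchySum * (T * B) := by
  have hw : ∀ i, 0 ≤ w i := fun i => (abs_nonneg _).trans (ha i)
  have hcont := continuous_expSum a y
  have hII : ∀ u v, IntervalIntegrable (fun r => 2 * ((1 - r / (2 * T)) * ‖expSum a y r‖ ^ 2))
      MeasureTheory.volume u v := fun u v => by
    apply Continuous.intervalIntegrable; fun_prop
  -- The doubled tent on `[0, 2T]` is at least 1 on `[0, T]`. Nonnegativity of the kernel then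
  -- allows signed masses `a` to be replaced by `w`.
  calc ∫ r in (0 : ℝ)..T, ‖expSum a y r‖ ^ 2
      ≤ ∫ r in (0 : ℝ)..T, 2 * ((1 - r / (2 * T)) * ‖expSum a y r‖ ^ 2) := by
        refine intervalIntegral.integral_mono_on hT.le
          (by apply Continuous.intervalIntegrable; fun_prop) (hII _ _) fun r hr => ?_
        have : r / (2 * T) ≤ 1 / 2 := by
          rw [div_le_div_iff₀ (by positivity) (by norm_num)]; linarith [hr.2]
        nlinarith [sq_nonneg ‖expSum a y r‖]
    _ ≤ ∫ r in (0 : ℝ)..2 * T, 2 * ((1 - r / (2 * T)) * ‖expSum a y r‖ ^ 2) := by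
        rw [← intervalIntegral.integral_add_adjacent_intervals (hII 0 T) (hII T (2 * T))]
        refine le_add_of_nonneg_right (intervalIntegral.integral_nonneg (by linarith) fun r hr => ?_)
        have : r / (2 * T) ≤ 1 := (div_le_one (by positivity)).2 hr.2
        have : 0 ≤ 1 - r / (2 * T) := by linarith
        positivity
    _ = 2 * ∑ i, ∑ k, a i * a k * fejerKernel (2 * T) (y i - y k) := by
        rw [intervalIntegral.integral_const_mul, integral_tent_mul_norm_sq_expSum]
    _ ≤ 2 * ∑ i, ∑ k, w i * (8 * T * (w k * (1 / (1 + (T * (y k - y i)) ^ 2)))) := by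
        refine mul_le_mul_of_nonneg_left (Finset.sum_le_sum fun i _ => Finset.sum_le_sum
          fun k _ => ?_) (by norm_num)
        have hk := fejerKernel_le (by positivity : 0 < 2 * T) (y i - y k)
        have hk0 := fejerKernel_nonneg (by positivity : 0 < 2 * T) (y i - y k)
        have h2 : 4 * (2 * T) / (1 + (2 * T * (y i - y k)) ^ 2) ≤
            8 * T * (1 / (1 + (T * (y k - y i)) ^ 2)) := by
          rw [mul_one_div, show 4 * (2 * T) = 8 * T by ring]
          refine div_le_div_of_nonneg_left (by positivity) (by positivity) ?_
          nlinarith [sq_nonneg (T * (y k - y i))]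
        have h3 : a i * a k ≤ w i * w k := by
          refine (le_abs_self _).trans ?_
          rw [abs_mul]
          exact mul_le_mul (ha i) (ha k) (abs_nonneg _) (hw i)
        calc _ ≤ w i * w k * fejerKernel (2 * T) (y i - y k) := mul_le_mul_of_nonneg_right h3 hk0
          _ ≤ w i * w k * (8 * T * (1 / (1 + (T * (y k - y i)) ^ 2))) :=
            mul_le_mul_of_nonneg_left (hk.trans h2) (mul_nonneg (hw i) (hw k))
          _ = _ := by ring
    _ ≤ 2 * ∑ i, w i * (8 * T * (3 * cauchySum * B)) := by
        refine mul_le_mul_of_nonneg_left (Finset.sum_le_sum fun i _ => ?_) (by norm_num)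
        rw [← Finset.mul_sum, ← Finset.mul_sum]
        exact mul_le_mul_of_nonneg_left (mul_le_mul_of_nonneg_left
          (sum_mul_cauchyKernel_le hw hT hB _) (by positivity)) (hw i)
    _ = _ := by rw [← Finset.sum_mul, hw1]; ring

end ExponentialSums

/-! ### Averaged decay and collision counting -/

section SobolevAndCollisions

/-- A one-dimensional Sobolev inequality. -/
theorem le_integral_add_abs_deriv {g g' : ℝ → ℝ} (hg : ∀ r, HasDerivAt g (g' r) r)
    (hg' : Continuous g') {l t : ℝ} (ht : t ∈ Set.Icc l (l + 1)) :
    g t ≤ ∫ r in l..(l + 1), (g r + |g' r|) := by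
  have hgc : Continuous g := continuous_iff_continuousAt.2 fun r => (hg r).continuousAt
  -- The claim follows by averaging this over `s`.
  have key : ∀ s ∈ Set.Icc l (l + 1), g t ≤ g s + ∫ r in l..(l + 1), |g' r| := by
    intro s hs
    have h1 : ∫ r in s..t, g' r = g t - g s :=
      intervalIntegral.integral_eq_sub_of_hasDerivAt (fun r _ => hg r)
        (hg'.intervalIntegrable _ _)
    have h2 : |∫ r in s..t, g' r| ≤ abs (∫ r in s..t, |g' r|) :=
      intervalIntegral.norm_integral_le_abs_integral_norm (f := g')
    have h3 : abs (∫ r in s..t, |g' r|) ≤ abs (∫ r in l..(l + 1), |g' r|) := by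
      refine intervalIntegral.abs_integral_mono_interval ?_
        (Filter.Eventually.of_forall fun r => abs_nonneg _) (hg'.abs.intervalIntegrable _ _)
      rw [Set.uIoc_of_le (by linarith : l ≤ l + 1)]
      exact Set.Ioc_subset_Ioc (le_min hs.1 ht.1) (max_le hs.2 ht.2)
    have h4 : 0 ≤ ∫ r in l..(l + 1), |g' r| :=
      intervalIntegral.integral_nonneg (by linarith) fun r _ => abs_nonneg _
    rw [abs_of_nonneg h4] at h3
    have := (le_abs_self _).trans (h2.trans h3)
    rw [h1] at this
    linarith
  have := intervalIntegral.integral_mono_on (μ := MeasureTheory.volume) (by linarith : l ≤ l + 1)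
    (continuous_const.intervalIntegrable _ _)
    ((hgc.fun_add continuous_const).intervalIntegrable _ _) key
  rw [intervalIntegral.integral_add (hgc.intervalIntegrable _ _)
    (continuous_const.intervalIntegrable _ _)] at this
  rw [intervalIntegral.integral_add (hgc.intervalIntegrable _ _)
    (hg'.abs.intervalIntegrable _ _)]
  simpa using this

variable {ι : Type*} [Fintype ι]

theorem hasDerivAt_expSum (a y : ι → ℝ) (r : ℝ) :
    HasDerivAt (expSum a y) (Complex.I * expSum (fun i => a i * y i) y r) r := by
  have h : ∀ i, HasDerivAt (fun r : ℝ => (a i : ℂ) * Complex.exp ((r * y i : ℝ) * Complex.I))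
      ((a i : ℂ) * (Complex.exp ((r * y i : ℝ) * Complex.I) * ((y i : ℝ) * Complex.I))) r := by
    intro i
    have h1 : HasDerivAt (fun r : ℝ => r * y i) (y i) r := by
      simpa using (hasDerivAt_id r).mul_const (y i)
    exact ((h1.ofReal_comp.mul_const Complex.I).cexp).const_mul _
  refine (HasDerivAt.fun_sum fun i _ => h i).congr_deriv ?_
  rw [expSum, Finset.mul_sum]
  refine Finset.sum_congr rfl fun i _ => ?_
  push_cast
  ring

/-- The derivative of |φ|² is at most |φ|² + |φ'|² in size, and φ' is, up to the factor i, again an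
exponential sum, so the energy estimate bounds both terms. -/
theorem norm_sq_expSum_le_integral (a y : ι → ℝ) {l t : ℝ} (ht : t ∈ Set.Icc l (l + 1)) :
    ‖expSum a y t‖ ^ 2 ≤ ∫ r in l..(l + 1),
      (2 * ‖expSum a y r‖ ^ 2 + ‖expSum (fun i => a i * y i) y r‖ ^ 2) := by
  have hc := continuous_expSum a y
  have hc' := continuous_expSum (fun i => a i * y i) y
  have hd : Continuous fun r => 2 * inner ℝ (expSum a y r)
      (Complex.I * expSum (fun i => a i * y i) y r) := by fun_prop
  refine (le_integral_add_abs_deriv (fun r => (hasDerivAt_expSum a y r).norm_sq) hd ht).trans ?_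
  refine intervalIntegral.integral_mono_on (by linarith)
    (by apply Continuous.intervalIntegrable; fun_prop)
    (by apply Continuous.intervalIntegrable; fun_prop) fun r _ => ?_
  have h := abs_real_inner_le_norm (expSum a y r) (Complex.I * expSum (fun i => a i * y i) y r)
  rw [norm_mul, Complex.norm_I, one_mul] at h
  rw [abs_mul, abs_two]
  nlinarith [sq_nonneg (‖expSum a y r‖ - ‖expSum (fun i => a i * y i) y r‖)]

/-- The average over `x` of the squared Fourier transform at `x r`. -/
theorem sum_mul_norm_sq_expSum_le {w y : ι → ℝ} (hw : ∀ i, 0 ≤ w i) (hw1 : ∑ i, w i = 1)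
    (hy : ∀ i, y i ∈ Set.Icc (0 : ℝ) (1 / 2)) {T : ℕ} (hT : 1 ≤ T) {B B' : ℝ}
    (hB : ∀ a : ℝ, ∑ i with y i ∈ Set.Ico a (a + (T : ℝ)⁻¹), w i ≤ B)
    (hB' : ∀ a : ℝ, ∑ i with y i ∈ Set.Ico a (a + (2 * T : ℝ)⁻¹), w i ≤ B') {r : ℝ}
    (hr : r ∈ Set.Icc (T : ℝ) (2 * T)) :
    ∑ i, w i * ‖expSum w y (y i * r)‖ ^ 2 ≤ B * (144 * cauchySum * (2 * T * B')) := by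
  classical
  have hT' : (1 : ℝ) ≤ T := by exact_mod_cast hT
  have hr0 : 0 < r := by linarith [hr.1]
  have hB0 : 0 ≤ B := (Finset.sum_nonneg fun i _ => hw i).trans (hB 0)
  have hc := continuous_expSum w y
  have hc' := continuous_expSum (fun i => w i * y i) y
  set h : ℝ → ℝ := fun r => 2 * ‖expSum w y r‖ ^ 2 + ‖expSum (fun i => w i * y i) y r‖ ^ 2 with hh
  have hhc : Continuous h := by fun_prop
  have hh0 : ∀ r, 0 ≤ h r := fun r => by positivity
  -- Since `y i ≤ 1/2` and `r ≤ 2T`, the floor is at most `T`. Points with the same floor lie in an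
  -- interval of length 1/r ≤ 1/T, hence have mass at most `B`.
  have hmaps : ∀ i ∈ Finset.univ, ⌊y i * r⌋₊ ∈ Finset.range (T + 1) := by
    intro i _
    rw [Finset.mem_range, Nat.floor_lt (mul_nonneg (hy i).1 hr0.le)]
    push_cast
    nlinarith [(hy i).2, hr.2, (hy i).1]
  calc ∑ i, w i * ‖expSum w y (y i * r)‖ ^ 2
      = ∑ l ∈ Finset.range (T + 1), ∑ i with ⌊y i * r⌋₊ = l, w i * ‖expSum w y (y i * r)‖ ^ 2 :=
        (Finset.sum_fiberwise_of_maps_to hmaps _).symm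
    _ ≤ ∑ l ∈ Finset.range (T + 1), B * ∫ s in (l : ℝ)..((l + 1 : ℕ) : ℝ), h s := by
        refine Finset.sum_le_sum fun l _ => ?_
        have hI : 0 ≤ ∫ s in (l : ℝ)..((l + 1 : ℕ) : ℝ), h s :=
          intervalIntegral.integral_nonneg (by simp) fun s _ => hh0 s
        have hfl : ∀ i, ⌊y i * r⌋₊ = l → (l : ℝ) ≤ y i * r ∧ y i * r < l + 1 := fun i hi =>
          (Nat.floor_eq_iff (mul_nonneg (hy i).1 hr0.le)).1 hi
        calc _ ≤ ∑ i with ⌊y i * r⌋₊ = l, w i * ∫ s in (l : ℝ)..((l + 1 : ℕ) : ℝ), h s := by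
              refine Finset.sum_le_sum fun i hi => mul_le_mul_of_nonneg_left ?_ (hw i)
              have := hfl i (Finset.mem_filter.1 hi).2
              push_cast
              exact norm_sq_expSum_le_integral w y ⟨this.1, this.2.le⟩
          _ = (∑ i with ⌊y i * r⌋₊ = l, w i) * ∫ s in (l : ℝ)..((l + 1 : ℕ) : ℝ), h s := by
              rw [Finset.sum_mul]
          _ ≤ _ := by
              refine mul_le_mul_of_nonneg_right ?_ hI
              refine le_trans (Finset.sum_le_sum_of_subset_of_nonneg ?_ fun i _ _ => hw i)
                (hB (l / r))
              intro i hi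
              have := hfl i (Finset.mem_filter.1 hi).2
              simp only [Finset.mem_filter, Finset.mem_univ, true_and, Set.mem_Ico]
              refine ⟨(div_le_iff₀ hr0).2 this.1, ?_⟩
              have h1 : y i < (l + 1) / r := (lt_div_iff₀ hr0).2 this.2
              have h2 : 1 / r ≤ (T : ℝ)⁻¹ := by
                rw [one_div]
                exact inv_anti₀ (by linarith) hr.1
              rw [add_div] at h1
              linarith
    _ = B * ∫ s in (0 : ℝ)..((T + 1 : ℕ) : ℝ), h s := by
        rw [← Finset.mul_sum, intervalIntegral.sum_integral_adjacent_intervals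
          (a := fun l : ℕ => (l : ℝ)) fun k _ => hhc.intervalIntegrable _ _]
        simp
    _ ≤ B * ∫ s in (0 : ℝ)..(2 * T : ℝ), h s := by
        refine mul_le_mul_of_nonneg_left ?_ hB0
        rw [← intervalIntegral.integral_add_adjacent_intervals
          (hhc.intervalIntegrable 0 ((T + 1 : ℕ) : ℝ)) (hhc.intervalIntegrable _ (2 * T : ℝ))]
        exact le_add_of_nonneg_right (intervalIntegral.integral_nonneg
          (by push_cast; linarith) fun s _ => hh0 s)
    _ ≤ _ := by
        refine mul_le_mul_of_nonneg_left ?_ hB0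
        simp only [hh]
        rw [intervalIntegral.integral_add (by apply Continuous.intervalIntegrable; fun_prop)
          (by apply Continuous.intervalIntegrable; fun_prop), intervalIntegral.integral_const_mul]
        -- The constant 144 is 3 · 48: twice the energy of φ plus once that of φ'.
        have h1 := integral_norm_sq_expSum_le (a := w) (fun i => (abs_of_nonneg (hw i)).le) hw1
          (by linarith) hB'
        have h2 := integral_norm_sq_expSum_le (a := fun i => w i * y i) (fun i => by
          rw [abs_of_nonneg (mul_nonneg (hw i) (hy i).1)]
          exact mul_le_of_le_one_right (hw i) (by linarith [(hy i).2])) hw1 (by linarith) hB'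
        linarith

/-- The bound for `∫ |φ r| ^ 2 ∑ x, w x |φ (x r)| ^ 2` under a Frostman condition with
exponent `3 / 4`. -/
theorem exists_integral_norm_sq_mul_le {q C : ℝ} (hq : 1 < q) (hq4 : q ^ 4 = 2) (hC : 0 ≤ C) :
    ∃ A : ℝ, 0 < A ∧ ∀ {ι : Type} [Fintype ι] (w y : ι → ℝ) (n : ℕ), (∀ i, 0 ≤ w i) →
      ∑ i, w i = 1 → (∀ i, y i ∈ Set.Icc (0 : ℝ) (1 / 2)) →
      (∀ m ≤ n, ∀ a : ℝ, ∑ i with y i ∈ Set.Ico a (a + ((2 : ℝ) ^ m)⁻¹), w i ≤ C / q ^ (3 * m)) →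
      ∫ r in (0 : ℝ)..2 ^ n, ‖expSum w y r‖ ^ 2 * ∑ x, w x * ‖expSum w y (y x * r)‖ ^ 2 ≤ A := by
  have hq0 : 0 < q := by linarith
  set D : ℝ := 144 * cauchySum * C ^ 2 * q * (48 * cauchySum * C * q) with hD
  have hD0 : 0 ≤ D := by have := cauchySum_nonneg; positivity
  have hqi : q⁻¹ < 1 := inv_lt_one_of_one_lt₀ hq
  have hqi' : 0 < (1 - q⁻¹)⁻¹ := inv_pos.2 (by linarith)
  refine ⟨1 + D * (1 - q⁻¹)⁻¹, by positivity, ?_⟩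
  intro ι _ w y n hw hw1 hy hμ
  have hc := continuous_expSum w y
  set f : ℝ → ℝ := fun r => ‖expSum w y r‖ ^ 2 * ∑ x, w x * ‖expSum w y (y x * r)‖ ^ 2 with hf
  have hfc : Continuous f := by fun_prop
  have h2 : ∀ j : ℕ, (2 : ℝ) ^ j = q ^ (3 * j) * q ^ j := fun j => by
    rw [← hq4, ← pow_mul, ← pow_add]; congr 1; ring
  have hM1 : ∀ r, ‖expSum w y r‖ ^ 2 ≤ 1 := fun r => by
    have := norm_expSum_le w y r
    simp only [abs_of_nonneg (hw _), hw1] at this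
    exact pow_le_one₀ (norm_nonneg _) this
  -- On this shell the average over `x` is O(q^(-2j)) and the energy is O(q^j).
  have hstep : ∀ j < n, ∫ r in (2 : ℝ) ^ j..2 ^ (j + 1), f r ≤ D * q⁻¹ ^ j := by
    intro j hj
    have hpow : (2 : ℝ) ^ j ≤ 2 ^ (j + 1) := pow_le_pow_right₀ (by norm_num) (Nat.le_succ j)
    have hG : ∀ r ∈ Set.Icc ((2 : ℝ) ^ j) (2 ^ (j + 1)),
        ∑ x, w x * ‖expSum w y (y x * r)‖ ^ 2 ≤
          C / q ^ (3 * j) * (144 * cauchySum * (C * q ^ (j + 1))) := by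
      intro r hr
      have := sum_mul_norm_sq_expSum_le hw hw1 hy (T := 2 ^ j) Nat.one_le_two_pow
        (B := C / q ^ (3 * j)) (B' := C / q ^ (3 * (j + 1))) (r := r)
        (by simpa using hμ j hj.le)
        (by simpa [pow_succ'] using hμ (j + 1) hj) (by simpa [pow_succ'] using hr)
      refine this.trans (le_of_eq ?_)
      congr 2
      push_cast
      rw [← pow_succ', h2 (j + 1)]
      field_simp
    have hE : ∫ r in (0 : ℝ)..2 ^ (j + 1), ‖expSum w y r‖ ^ 2 ≤
        48 * cauchySum * (C * q ^ (j + 1)) := by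
      refine (integral_norm_sq_expSum_le (a := w) (fun i => (abs_of_nonneg (hw i)).le) hw1
        (by positivity) (hμ (j + 1) hj)).trans (le_of_eq ?_)
      congr 1
      rw [h2 (j + 1)]
      field_simp
    have hG0 : 0 ≤ C / q ^ (3 * j) * (144 * cauchySum * (C * q ^ (j + 1))) := by
      have := cauchySum_nonneg; positivity
    calc ∫ r in (2 : ℝ) ^ j..2 ^ (j + 1), f r
        ≤ ∫ r in (2 : ℝ) ^ j..2 ^ (j + 1), ‖expSum w y r‖ ^ 2 *
            (C / q ^ (3 * j) * (144 * cauchySum * (C * q ^ (j + 1)))) :=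
          intervalIntegral.integral_mono_on hpow (hfc.intervalIntegrable _ _)
            (by apply Continuous.intervalIntegrable; fun_prop) fun r hr =>
            mul_le_mul_of_nonneg_left (hG r hr) (by positivity)
      _ = (∫ r in (2 : ℝ) ^ j..2 ^ (j + 1), ‖expSum w y r‖ ^ 2) *
            (C / q ^ (3 * j) * (144 * cauchySum * (C * q ^ (j + 1)))) := by
          rw [intervalIntegral.integral_mul_const]
      _ ≤ 48 * cauchySum * (C * q ^ (j + 1)) *
            (C / q ^ (3 * j) * (144 * cauchySum * (C * q ^ (j + 1)))) := by
          refine mul_le_mul_of_nonneg_right (le_trans ?_ hE) hG0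
          rw [← intervalIntegral.integral_add_adjacent_intervals
            (a := 0) (b := 2 ^ j) (by apply Continuous.intervalIntegrable; fun_prop)
            (by apply Continuous.intervalIntegrable; fun_prop)]
          exact le_add_of_nonneg_left (intervalIntegral.integral_nonneg (by positivity)
            fun r _ => by positivity)
      _ = D * q⁻¹ ^ j := by
          rw [hD, inv_pow, mul_comm 3 j, pow_mul', pow_succ]
          field_simp
          ring
  have hsum : ∀ m ≤ n, ∫ r in (0 : ℝ)..2 ^ m, f r ≤ 1 + D * ∑ j ∈ Finset.range m, q⁻¹ ^ j := by
    intro m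
    induction m with
    | zero =>
      intro _
      have : ∫ r in (0 : ℝ)..1, f r ≤ ∫ r in (0 : ℝ)..1, (1 : ℝ) := by
        refine intervalIntegral.integral_mono_on zero_le_one (hfc.intervalIntegrable _ _)
          (continuous_const.intervalIntegrable _ _) fun r _ => ?_
        refine mul_le_one₀ (hM1 r) (Finset.sum_nonneg fun x _ =>
          mul_nonneg (hw x) (by positivity)) ?_
        rw [← hw1]
        exact Finset.sum_le_sum fun x _ => mul_le_of_le_one_right (hw x) (hM1 _)
      simpa using this
    | succ m ih =>
      intro hm
      rw [← intervalIntegral.integral_add_adjacent_intervals (hfc.intervalIntegrable 0 (2 ^ m))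
        (hfc.intervalIntegrable _ _), Finset.sum_range_succ]
      have := ih (by omega)
      have := hstep m (by omega)
      linarith
  refine (hsum n le_rfl).trans ?_
  have : ∑ j ∈ Finset.range n, q⁻¹ ^ j ≤ (1 - q⁻¹)⁻¹ := by
    rw [← tsum_geometric_of_lt_one (by positivity) hqi]
    exact (summable_geometric_of_lt_one (by positivity) hqi).sum_le_tsum _
      fun j _ => by positivity
  gcongr

/-- A collision bound gives a lower bound for the measure of a neighbourhood. -/
theorem le_volume_cthickening_of_collisions {b t : ι → ℝ} (hb : ∀ i, 0 ≤ b i)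
    (hb1 : ∑ i, b i = 1) {δ A : ℝ} (hδ : 0 < δ) (hA : 0 < A)
    (hJ : ∑ i, ∑ k, (if |t i - t k| ≤ δ then b i * b k else 0) ≤ A * δ) :
    ENNReal.ofReal A⁻¹ ≤ MeasureTheory.volume (Metric.cthickening δ (Set.range t)) := by
  classical
  set fl : ι → ℤ := fun i => ⌊t i / δ⌋ with hfl
  set I := Finset.univ.image fl
  have hfl' : ∀ i, fl i * δ ≤ t i ∧ t i < (fl i + 1) * δ := fun i =>
    ⟨(le_div_iff₀ hδ).1 (Int.floor_le _), (div_lt_iff₀ hδ).1 (Int.lt_floor_add_one _)⟩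
  have hmaps : ∀ i ∈ Finset.univ, fl i ∈ I := fun i hi => Finset.mem_image_of_mem _ hi
  -- Cauchy–Schwarz over the occupied cells of length `δ`; two points in the same cell collide.
  have hcount : 1 ≤ (I.card : ℝ) * (A * δ) := by
    calc (1 : ℝ) = (∑ l ∈ I, ∑ i with fl i = l, b i) ^ 2 := by
          rw [Finset.sum_fiberwise_of_maps_to hmaps, hb1, one_pow]
      _ ≤ I.card * ∑ l ∈ I, (∑ i with fl i = l, b i) ^ 2 := sq_sum_le_card_mul_sum_sq
      _ ≤ I.card * (A * δ) := by
          refine mul_le_mul_of_nonneg_left (le_trans ?_ hJ) (by positivity)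
          rw [← Finset.sum_fiberwise_of_maps_to hmaps]
          refine Finset.sum_le_sum fun l _ => ?_
          rw [sq, Finset.sum_mul]
          refine Finset.sum_le_sum fun i hi => ?_
          rw [Finset.mul_sum, Finset.sum_filter]
          refine Finset.sum_le_sum fun k _ => ?_
          have hi' := (Finset.mem_filter.1 hi).2
          split_ifs with h1 h2 h2
          · exact le_rfl
          · refine absurd (abs_le.2 ?_) h2
            have hi2 := hfl' i
            have hk2 := hfl' k
            rw [hi'] at hi2
            rw [h1] at hk2
            constructor <;> linarith [hi2.1, hi2.2, hk2.1, hk2.2]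
          · exact mul_nonneg (hb i) (hb k)
          · exact le_rfl
  have hsub : (⋃ l ∈ I, Set.Ico ((l : ℝ) * δ) ((l + 1) * δ)) ⊆
      Metric.cthickening δ (Set.range t) := by
    intro s hs
    simp only [Set.mem_iUnion] at hs
    obtain ⟨l, hl, hs⟩ := hs
    obtain ⟨i, -, rfl⟩ := Finset.mem_image.1 hl
    refine Metric.mem_cthickening_of_dist_le s (t i) δ _ ⟨i, rfl⟩ ?_
    rw [Real.dist_eq, abs_le]
    constructor <;> linarith [hs.1, hs.2, (hfl' i).1, (hfl' i).2]
  refine le_trans ?_ (MeasureTheory.measure_mono hsub)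
  rw [MeasureTheory.measure_biUnion_finset ?_ fun l _ => measurableSet_Ico]
  · have : ∀ l : ℤ, MeasureTheory.volume (Set.Ico ((l : ℝ) * δ) ((l + 1) * δ)) =
        ENNReal.ofReal δ := fun l => by rw [Real.volume_Ico]; congr 1; ring
    simp only [this, Finset.sum_const, nsmul_eq_mul]
    rw [← ENNReal.ofReal_natCast, ← ENNReal.ofReal_mul (by positivity)]
    refine ENNReal.ofReal_le_ofReal ?_
    rw [inv_le_iff_one_le_mul₀ hA]
    linarith
  · intro l _ l' _ hne
    refine Set.disjoint_left.2 fun s hs hs' => hne ?_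
    have h1 : (l : ℝ) < l' + 1 := lt_of_mul_lt_mul_right (hs.1.trans_lt hs'.2) hδ.le
    have h2 : (l' : ℝ) < l + 1 := lt_of_mul_lt_mul_right (hs'.1.trans_lt hs.2) hδ.le
    have h1' : l < l' + 1 := by exact_mod_cast h1
    have h2' : l' < l + 1 := by exact_mod_cast h2
    omega

/-- A finite form of Falconer's exceptional set estimate for projections. -/
theorem exists_le_volume_cthickening {q C : ℝ} (hq : 1 < q) (hq4 : q ^ 4 = 2) (hC : 0 ≤ C) :
    ∃ c : ℝ, 0 < c ∧ ∀ {ι : Type} [Fintype ι] (w y : ι → ℝ) (n : ℕ), (∀ i, 0 ≤ w i) →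
      ∑ i, w i = 1 → (∀ i, y i ∈ Set.Icc (0 : ℝ) (1 / 2)) →
      (∀ m ≤ n, ∀ a : ℝ, ∑ i with y i ∈ Set.Ico a (a + ((2 : ℝ) ^ m)⁻¹), w i ≤ C / q ^ (3 * m)) →
      ∃ x, ENNReal.ofReal c ≤ MeasureTheory.volume (Metric.cthickening (2 ^ n)⁻¹
        (Set.range fun α : ι × ι => y α.1 + y x * y α.2)) := by
  obtain ⟨A, hA, henergy⟩ := exists_integral_norm_sq_mul_le hq hq4 hC
  refine ⟨(4 * A)⁻¹, by positivity, ?_⟩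
  intro ι _ w y n hw hw1 hy hμ
  have hL : (0 : ℝ) < 2 ^ n := by positivity
  set b : ι × ι → ℝ := fun α => w α.1 * w α.2 with hb
  set t : ι → ι × ι → ℝ := fun x α => y α.1 + y x * y α.2 with ht
  have hb0 : ∀ α, 0 ≤ b α := fun α => mul_nonneg (hw _) (hw _)
  have hb1 : ∑ α, b α = 1 := by
    simp only [hb, Fintype.sum_prod_type, ← Finset.mul_sum, hw1, mul_one]
  have hc := continuous_expSum w y
  have hJ : ∀ x, ∑ α, ∑ β, (if |t x α - t x β| ≤ (2 ^ n)⁻¹ then b α * b β else 0) ≤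
      4 * (2 ^ n)⁻¹ * ∫ r in (0 : ℝ)..2 ^ n,
        ‖expSum w y r‖ ^ 2 * ‖expSum w y (y x * r)‖ ^ 2 := by
    intro x
    calc _ ≤ ∑ α, ∑ β, 4 * (2 ^ n)⁻¹ * (b α * b β * fejerKernel (2 ^ n) (t x α - t x β)) := by
          refine Finset.sum_le_sum fun α _ => Finset.sum_le_sum fun β _ => ?_
          have hbb := mul_nonneg (hb0 α) (hb0 β)
          split_ifs with h
          · have hk := le_fejerKernel hL (z := t x α - t x β) (by
              rw [abs_mul, abs_of_pos hL, mul_comm, ← le_div_iff₀ hL, one_div]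
              exact h)
            have h1 : (1 : ℝ) ≤ 4 * (2 ^ n)⁻¹ * fejerKernel (2 ^ n) (t x α - t x β) := by
              calc (1 : ℝ) = 4 * (2 ^ n)⁻¹ * (2 ^ n / 4) := by field_simp
                _ ≤ _ := mul_le_mul_of_nonneg_left hk (by positivity)
            nlinarith [mul_le_mul_of_nonneg_left h1 hbb]
          · have := fejerKernel_nonneg hL (t x α - t x β)
            positivity
      _ = 4 * (2 ^ n)⁻¹ * ∫ r in (0 : ℝ)..2 ^ n, (1 - r / 2 ^ n) * ‖expSum b (t x) r‖ ^ 2 := by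
          rw [integral_tent_mul_norm_sq_expSum, Finset.mul_sum]
          simp only [Finset.mul_sum]
      _ ≤ _ := by
          refine mul_le_mul_of_nonneg_left ?_ (by positivity)
          have hcb := continuous_expSum b (t x)
          refine intervalIntegral.integral_mono_on hL.le
            (by apply Continuous.intervalIntegrable; fun_prop)
            (by apply Continuous.intervalIntegrable; fun_prop) fun r hr => ?_
          rw [hb, ht, expSum_prod, norm_mul, mul_pow]
          refine mul_le_of_le_one_left (by positivity) ?_
          have := div_nonneg hr.1 hL.le
          linarith
  -- Averaging over `x` produces exactly the integral bounded by `A`; some `x` is then no worse than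
  -- average.
  have hav : ∑ x, w x * ∑ α, ∑ β, (if |t x α - t x β| ≤ (2 ^ n)⁻¹ then b α * b β else 0) ≤
      4 * A * (2 ^ n)⁻¹ := by
    calc _ ≤ ∑ x, w x * (4 * (2 ^ n)⁻¹ * ∫ r in (0 : ℝ)..2 ^ n,
          ‖expSum w y r‖ ^ 2 * ‖expSum w y (y x * r)‖ ^ 2) :=
          Finset.sum_le_sum fun x _ => mul_le_mul_of_nonneg_left (hJ x) (hw x)
      _ = 4 * (2 ^ n)⁻¹ * ∫ r in (0 : ℝ)..2 ^ n,
          ‖expSum w y r‖ ^ 2 * ∑ x, w x * ‖expSum w y (y x * r)‖ ^ 2 := by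
          simp only [Finset.mul_sum]
          rw [intervalIntegral.integral_finsetSum fun i _ => by
            apply Continuous.intervalIntegrable; fun_prop, Finset.mul_sum]
          refine Finset.sum_congr rfl fun x _ => ?_
          rw [mul_left_comm, ← intervalIntegral.integral_const_mul]
          congr 2
          ext r
          ring
      _ ≤ 4 * (2 ^ n)⁻¹ * A := mul_le_mul_of_nonneg_left (henergy w y n hw hw1 hy hμ) (by positivity)
      _ = _ := by ring
  obtain ⟨x, hx⟩ : ∃ x, ∑ α, ∑ β, (if |t x α - t x β| ≤ (2 ^ n)⁻¹ then b α * b β else 0) ≤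
      4 * A * (2 ^ n)⁻¹ := by
    by_contra! hcon
    obtain ⟨x₀, -, hx₀⟩ : ∃ x ∈ Finset.univ, w x ≠ 0 :=
      Finset.exists_ne_zero_of_sum_ne_zero (by rw [hw1]; exact one_ne_zero)
    have : ∑ x, w x * (4 * A * (2 ^ n)⁻¹) <
        ∑ x, w x * ∑ α, ∑ β, (if |t x α - t x β| ≤ (2 ^ n)⁻¹ then b α * b β else 0) :=
      Finset.sum_lt_sum (fun x _ => mul_le_mul_of_nonneg_left (hcon x).le (hw x))
        ⟨x₀, Finset.mem_univ _, mul_lt_mul_of_pos_left (hcon x₀) ((hw x₀).lt_of_ne' hx₀)⟩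
    rw [← Finset.sum_mul, hw1, one_mul] at this
    linarith
  exact ⟨x, le_volume_cthickening_of_collisions hb0 hb1 (by positivity) (by positivity) hx⟩

end SobolevAndCollisions

/-! ### Frostman measures, positive measure and Steinhaus -/

section Falconer

open Filter Topology MeasureTheory

theorem inv_two_pow_rpow_three_quarters {q : ℝ} (hq : 0 < q) (hq4 : q ^ 4 = 2) (m : ℕ) :
    (((2 : ℝ) ^ m)⁻¹) ^ ((3 / 4 : NNReal) : ℝ) = (q ^ (3 * m))⁻¹ := by
  have h : ((2 : ℝ) ^ m)⁻¹ = ((q ^ m)⁻¹) ^ (4 : ℝ) := by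
    rw [← hq4, show (4 : ℝ) = ((4 : ℕ) : ℝ) by norm_num, Real.rpow_natCast, inv_pow, ← pow_mul,
      ← pow_mul, mul_comm]
  rw [h, ← Real.rpow_mul (by positivity)]
  rw [show (4 : ℝ) * ((3 / 4 : NNReal) : ℝ) = ((3 : ℕ) : ℝ) by push_cast; norm_num,
    Real.rpow_natCast, inv_pow, ← pow_mul, mul_comm]

/-- A set of dimension greater than `3 / 4` has positive dyadic Hausdorff content. -/
theorem exists_pos_le_sum_of_dyadic_cover {K : Set ℝ} {q : ℝ} (hq : 1 < q) (hq4 : q ^ 4 = 2)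
    (hK : ((3 / 4 : NNReal) : ENNReal) < dimH K) :
    ∃ c : ℝ, 0 < c ∧ ∀ (T : Finset (ℕ × ℕ)) (m : ℕ × ℕ → ℕ),
      (K ⊆ ⋃ u : T, Set.Ico ((u.1.2 : ℝ) / 2 ^ m u.1) ((u.1.2 + 1) / 2 ^ m u.1)) →
      c ≤ ∑ u ∈ T, (q ^ (3 * m u))⁻¹ := by
  have hq0 : 0 < q := by linarith
  by_contra! hcon
  -- Covers with sums tending to 0 have mesh tending to 0, since 2^(-m) = q^(-4m) ≤ q^(-3m). The
  -- 3/4-dimensional Hausdorff measure of `K` would vanish, yet it is infinite.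
  choose T m hcov hlt using fun k : ℕ => hcon (1 / ((k : ℝ) + 1)) (by positivity)
  have hdiam : ∀ k (u : T k), Metric.ediam (Set.Ico ((u.1.2 : ℝ) / 2 ^ m k u.1)
      ((u.1.2 + 1) / 2 ^ m k u.1)) = ENNReal.ofReal ((2 ^ m k u.1)⁻¹) := by
    intro k u
    rw [Real.ediam_Ico]
    congr 1
    field_simp
    ring
  have hlim : Tendsto (fun k : ℕ => ENNReal.ofReal (1 / ((k : ℝ) + 1))) atTop (𝓝 0) := by
    rw [← ENNReal.ofReal_zero]
    exact ENNReal.tendsto_ofReal tendsto_one_div_add_atTop_nhds_zero_nat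
  have h := Measure.hausdorffMeasure_le_liminf_sum ((3 / 4 : NNReal) : ℝ) K _ hlim
    (fun k (u : T k) => Set.Ico ((u.1.2 : ℝ) / 2 ^ m k u.1) ((u.1.2 + 1) / 2 ^ m k u.1))
    (Eventually.of_forall fun k u => by
      rw [hdiam]
      refine ENNReal.ofReal_le_ofReal (le_trans ?_ (hlt k).le)
      refine le_trans ?_ (Finset.single_le_sum (f := fun u => (q ^ (3 * m k u))⁻¹)
        (fun u _ => by positivity) u.2)
      rw [← hq4, ← pow_mul]
      exact inv_anti₀ (by positivity) (pow_le_pow_right₀ hq.le (by omega)))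
    (Eventually.of_forall hcov)
  rw [hausdorffMeasure_of_lt_dimH hK, top_le_iff] at h
  have hle : liminf (fun k => ∑ u : T k, Metric.ediam (Set.Ico ((u.1.2 : ℝ) / 2 ^ m k u.1)
      ((u.1.2 + 1) / 2 ^ m k u.1)) ^ ((3 / 4 : NNReal) : ℝ)) atTop ≤ 0 := by
    rw [← hlim.liminf_eq]
    refine liminf_le_liminf (Eventually.of_forall fun k => ?_)
    refine le_trans (le_of_eq ?_) (ENNReal.ofReal_le_ofReal (hlt k).le)
    rw [ENNReal.ofReal_sum_of_nonneg (fun u _ => by positivity), ← Finset.sum_coe_sort (T k)]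
    refine Finset.sum_congr rfl fun u _ => ?_
    rw [hdiam, ENNReal.ofReal_rpow_of_nonneg (by positivity) (by positivity),
      inv_two_pow_rpow_three_quarters hq0 hq4]
  rw [h] at hle
  simp at hle

/-- Discrete Frostman measures on a set of dimension greater than `3 / 4`. -/
theorem exists_frostman_weights {K : Set ℝ} {q : ℝ} (hq : 1 < q) (hq4 : q ^ 4 = 2)
    (hK01 : K ⊆ Set.Icc 0 (1 / 2)) (hK : ((3 / 4 : NNReal) : ENNReal) < dimH K) :
    ∃ C : ℝ, 0 ≤ C ∧ ∀ n : ℕ, ∃ (ι : Type) (_ : Fintype ι) (w y : ι → ℝ), (∀ i, 0 ≤ w i) ∧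
      ∑ i, w i = 1 ∧ (∀ i, y i ∈ K) ∧
      ∀ m ≤ n, ∀ a : ℝ,
        ∑ i with y i ∈ Set.Ico a (a + ((2 : ℝ) ^ m)⁻¹), w i ≤ C / q ^ (3 * m) := by
  classical
  have hq0 : 0 < q := by linarith
  obtain ⟨c, hc, hcov⟩ := exists_pos_le_sum_of_dyadic_cover hq hq4 hK
  refine ⟨2 / c, by positivity, fun n => ?_⟩
  set P : Finset ℕ := {p ∈ Finset.range (2 ^ n) |
    (K ∩ Set.Ico ((p : ℝ) / 2 ^ n) ((p + 1) / 2 ^ n)).Nonempty} with hP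
  -- Leaves are dyadic intervals of length 2^(-n), so a vertex of height `j` has length 2^(-(n-j));
  -- its capacity is that length to the power 3/4.
  obtain ⟨w, hw0, -, hwτ, T, hTn, hTc, hTw⟩ := exists_binaryTree_weights
    (fun j => (q ^ (3 * (n - j)))⁻¹) (fun j => by positivity) P n 0
  have hsplit : ∀ j ≤ n, (2 : ℝ) ^ n / ((2 ^ j : ℕ) : ℝ) = 2 ^ (n - j) := fun j hj => by
    rw [Nat.cast_pow, Nat.cast_ofNat, div_eq_iff (by positivity), ← pow_add, Nat.sub_add_cancel hj]
  have hW : c ≤ ∑ p ∈ P, w p := by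
    refine le_trans (hcov T (fun u => n - u.1) ?_) hTw
    intro x hx
    have hx01 := hK01 hx
    have hx0 : 0 ≤ x * 2 ^ n := mul_nonneg hx01.1 (by positivity)
    have hlt : ⌊x * 2 ^ n⌋₊ < 2 ^ n := by
      rw [Nat.floor_lt hx0]
      push_cast
      have : (0 : ℝ) < 2 ^ n := by positivity
      nlinarith [hx01.2]
    have hmem : ⌊x * 2 ^ n⌋₊ ∈ P := by
      refine Finset.mem_filter.2 ⟨Finset.mem_range.2 hlt, x, hx, ?_, ?_⟩
      · exact (div_le_iff₀ (by positivity)).2 (Nat.floor_le hx0)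
      · exact (lt_div_iff₀ (by positivity)).2 (Nat.lt_floor_add_one _)
    obtain ⟨u, hu, hpu⟩ := hTc _ hmem (Nat.div_eq_of_lt hlt)
    refine Set.mem_iUnion.2 ⟨⟨u, hu⟩, ?_⟩
    rw [← Nat.floor_div_natCast, mul_div_assoc, hsplit _ (hTn u hu),
      Nat.floor_eq_iff (mul_nonneg hx01.1 (by positivity))] at hpu
    exact ⟨(div_le_iff₀ (by positivity)).2 hpu.1, (lt_div_iff₀ (by positivity)).2 hpu.2⟩
  set W := ∑ p ∈ P, w p with hWdef
  have hW0 : 0 < W := hc.trans_le hW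
  choose y hyK hyI using fun p : P => (Finset.mem_filter.1 p.2).2
  refine ⟨P, inferInstance, fun p => w p / W, y, fun p => div_nonneg (hw0 _) hW0.le, ?_, hyK, ?_⟩
  · rw [← Finset.sum_div, Finset.sum_coe_sort P w, ← hWdef, div_self hW0.ne']
  · clear_value W P
    intro m hm a
    have h2m : (0 : ℝ) < 2 ^ m := by positivity
    set l := ⌊a * 2 ^ m⌋₊ with hl
    -- An interval of length 2^(-m) meets at most two dyadic intervals of that length, whence the 2
    -- in `2 / c`. For `a < 0` the natural floor gives `l = 0`, harmless as the points are
    -- nonnegative.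
    have hidx : ∀ p : P, y p ∈ Set.Ico a (a + ((2 : ℝ) ^ m)⁻¹) →
        (p : ℕ) / 2 ^ (n - m) = l ∨ (p : ℕ) / 2 ^ (n - m) = l + 1 := by
      intro p hp
      have hy0 : 0 ≤ y p := (hK01 (hyK p)).1
      have hfl : ⌊y p * 2 ^ n⌋₊ = (p : ℕ) := by
        rw [Nat.floor_eq_iff (by positivity)]
        exact ⟨(div_le_iff₀ (by positivity)).1 (hyI p).1, (lt_div_iff₀ (by positivity)).1 (hyI p).2⟩
      have hfl' : (p : ℕ) / 2 ^ (n - m) = ⌊y p * 2 ^ m⌋₊ := by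
        rw [← hfl, ← Nat.floor_div_natCast, mul_div_assoc, hsplit _ (Nat.sub_le _ _),
          Nat.sub_sub_self hm]
      have h1 : l ≤ ⌊y p * 2 ^ m⌋₊ :=
        Nat.floor_le_floor (mul_le_mul_of_nonneg_right hp.1 h2m.le)
      have h2 : ⌊y p * 2 ^ m⌋₊ < l + 2 := by
        rw [Nat.floor_lt (by positivity)]
        have := mul_lt_mul_of_pos_right hp.2 h2m
        rw [add_mul, inv_mul_cancel₀ h2m.ne'] at this
        have h3 := Nat.lt_floor_add_one (a * 2 ^ m)
        push_cast
        linarith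
      omega
    calc ∑ p : P with y p ∈ Set.Ico a (a + ((2 : ℝ) ^ m)⁻¹), w p / W
        = (∑ p : P with y p ∈ Set.Ico a (a + ((2 : ℝ) ^ m)⁻¹), w p) / W := by
          rw [Finset.sum_div]
      _ ≤ (∑ p ∈ P with p / 2 ^ (n - m) = l, w p +
            ∑ p ∈ P with p / 2 ^ (n - m) = l + 1, w p) / W := by
          refine div_le_div_of_nonneg_right ?_ hW0.le
          rw [Finset.sum_filter, Finset.sum_filter, Finset.sum_filter, ← Finset.sum_add_distrib,
            ← Finset.sum_coe_sort P]
          refine Finset.sum_le_sum fun p _ => ?_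
          have := hw0 p
          split_ifs with h1 h2 h3 h3 <;> try linarith
          rcases hidx p h1 with h | h
          exacts [absurd h h2, absurd h h3]
      _ ≤ ((q ^ (3 * (n - (n - m))))⁻¹ + (q ^ (3 * (n - (n - m))))⁻¹) / W := by
          refine div_le_div_of_nonneg_right (add_le_add ?_ ?_) hW0.le
          exacts [hwτ _ (Nat.sub_le _ _) _, hwτ _ (Nat.sub_le _ _) _]
      _ = 2 / W / q ^ (3 * m) := by
          rw [Nat.sub_sub_self hm]
          field_simp
          norm_num
      _ ≤ 2 / c / q ^ (3 * m) := by gcongr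

/-- If a compact set `K` has dimension greater than `3 / 4`, then `K + x K` has positive Lebesgue
measure for some `x ∈ K`. -/
theorem exists_mem_volume_add_smul_pos {K : Set ℝ} (hKc : IsCompact K)
    (hK01 : K ⊆ Set.Icc 0 (1 / 2)) (hK : ((3 / 4 : NNReal) : ENNReal) < dimH K) :
    ∃ x ∈ K, 0 < volume (K + x • K) := by
  obtain ⟨q, hq, hq4⟩ : ∃ q : ℝ, 1 < q ∧ q ^ 4 = 2 := by
    refine ⟨2 ^ (1 / 4 : ℝ), Real.one_lt_rpow (by norm_num) (by norm_num), ?_⟩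
    rw [← Real.rpow_natCast, ← Real.rpow_mul (by norm_num)]
    norm_num
  obtain ⟨C, hC, hw⟩ := exists_frostman_weights hq hq4 hK01 hK
  obtain ⟨c, hc, hvol⟩ := exists_le_volume_cthickening hq hq4 hC
  have hex : ∀ n : ℕ, ∃ x ∈ K,
      ENNReal.ofReal c ≤ volume (Metric.cthickening (2 ^ n)⁻¹ (K + x • K)) := by
    intro n
    obtain ⟨ι, _, w, y, hw0, hw1, hyK, hμ⟩ := hw n
    obtain ⟨x, hx⟩ := hvol w y n hw0 hw1 (fun i => hK01 (hyK i)) hμ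
    refine ⟨y x, hyK x, hx.trans (measure_mono (Metric.cthickening_subset_of_subset _ ?_))⟩
    rintro _ ⟨α, rfl⟩
    exact Set.add_mem_add (hyK _) (Set.smul_mem_smul_set (hyK _))
  choose x hxK hx using hex
  obtain ⟨z, hz, φ, hφ, hlim⟩ := hKc.tendsto_subseq hxK
  refine ⟨z, hz, ?_⟩
  have hcompact : IsCompact (K + z • K) := hKc.add (hKc.smul z)
  -- Replacing `x (φ n)` by `z` moves points by at most |x (φ n) - z|, so a fixed thickening for `z`
  -- contains fine ones for `x (φ n)`.
  have hthick : ∀ ε > 0, ENNReal.ofReal c ≤ volume (Metric.cthickening ε (K + z • K)) := by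
    intro ε hε
    have h1 : ∀ᶠ n in atTop, dist (x (φ n)) z < ε / 2 :=
      (Metric.tendsto_nhds.1 hlim) _ (by positivity)
    have h2 : ∀ᶠ n in atTop, ((2 : ℝ) ^ φ n)⁻¹ < ε / 2 := by
      have : Tendsto (fun n : ℕ => ((2 : ℝ) ^ n)⁻¹) atTop (𝓝 0) :=
        (tendsto_pow_atTop_atTop_of_one_lt (by norm_num)).inv_tendsto_atTop
      exact (this.comp hφ.tendsto_atTop).eventually (gt_mem_nhds (by positivity))
    obtain ⟨n, hn1, hn2⟩ := (h1.and h2).exists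
    refine (hx (φ n)).trans (measure_mono ?_)
    have hsub : K + x (φ n) • K ⊆ Metric.cthickening (ε / 2) (K + z • K) := by
      rintro _ ⟨e, he, _, ⟨f, hf, rfl⟩, rfl⟩
      refine Metric.mem_cthickening_of_dist_le _ (e + z • f) _ _
        (Set.add_mem_add he (Set.smul_mem_smul_set hf)) ?_
      have hf' := hK01 hf
      simp only [smul_eq_mul]
      rw [dist_add_left, Real.dist_eq, ← sub_mul, abs_mul, abs_of_nonneg hf'.1]
      rw [Real.dist_eq] at hn1
      nlinarith [hf'.2, hf'.1, abs_nonneg (x (φ n) - z)]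
    refine (Metric.cthickening_subset_of_subset _ hsub).trans ?_
    refine (Metric.cthickening_cthickening_subset (by positivity) (by positivity) _).trans ?_
    exact Metric.cthickening_mono (by linarith) _
  have hlimv := (tendsto_measure_cthickening_of_isCompact (μ := volume) hcompact).mono_left
    (nhdsWithin_le_nhds (s := Set.Ioi 0))
  have := ge_of_tendsto hlimv (eventually_mem_nhdsWithin.mono hthick)
  exact (ENNReal.ofReal_pos.2 hc).trans_le this

/-- The sum of a compact set of positive measure with itself contains an interval. -/
theorem IsCompact.exists_Icc_subset_add {P : Set ℝ} (hP : IsCompact P) (hpos : 0 < volume P) :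
    ∃ c η : ℝ, 0 < η ∧ Set.Icc (c - η) (c + η) ⊆ P + P := by
  -- By Fubini the measure of P ∩ (c - P) integrates over `c` to |P|² > 0. For a, b in this set, a +
  -- (c - b) lies in P + P, and the differences a - b fill a neighbourhood of 0.
  obtain ⟨c, hc⟩ : ∃ c : ℝ, 0 < volume (P ∩ {x | c - x ∈ P}) := by
    by_contra! hcon
    set A : Set (ℝ × ℝ) := {a | a.2 ∈ P ∧ a.1 - a.2 ∈ P} with hA
    have hAm : MeasurableSet A :=
      (measurable_snd hP.measurableSet).inter ((measurable_fst.sub measurable_snd) hP.measurableSet)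
    have h0 : (volume.prod volume) A = 0 := by
      rw [Measure.measure_prod_null hAm]
      exact Eventually.of_forall fun c => nonpos_iff_eq_zero.1 (hcon c)
    rw [Measure.prod_apply_symm hAm] at h0
    have h1 : ∫⁻ x in P, volume P ≤ ∫⁻ x, volume ((fun c => (c, x)) ⁻¹' A) := by
      refine le_trans (setLIntegral_mono' hP.measurableSet fun x hx => ?_)
        (setLIntegral_le_lintegral P _)
      have : (fun c => (c, x)) ⁻¹' A = (fun c => c - x) ⁻¹' P := by
        ext c
        simp [hA, hx]
      rw [this]
      simp only [sub_eq_add_neg]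
      rw [measure_preimage_add_right]
    rw [h0, setLIntegral_const] at h1
    simp [hpos.ne'] at h1
  have hm : MeasurableSet (P ∩ {x | c - x ∈ P}) :=
    hP.measurableSet.inter ((measurable_const.sub measurable_id) hP.measurableSet)
  obtain ⟨ε, hε, hball⟩ := Metric.mem_nhds_iff.1
    (Measure.sub_mem_nhds_zero_of_addHaar_pos volume _ hm hc)
  refine ⟨c, ε / 2, by positivity, fun t ht => ?_⟩
  obtain ⟨a, ha, b, hb, hab⟩ := hball (show t - c ∈ Metric.ball 0 ε by
    rw [Metric.mem_ball, dist_zero_right, Real.norm_eq_abs, abs_lt]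
    constructor <;> linarith [ht.1, ht.2])
  exact ⟨a, ha.1, c - b, hb.2, by simp only at hab ⊢; linarith⟩

end Falconer

/-! ### Digit shifts and sums in an Erdős semigroup -/

section ErdosSemigroup

theorem isBinarySubsequence_div_two_pow {x : ℝ} (hx : x ∈ Set.Ico (0 : ℝ) 1) {N : ℕ}
    (hN : 0 < N) : IsBinarySubsequence (x / 2 ^ N) x := by
  refine ⟨N, hN, fun j hj => ?_, fun i hi => ?_⟩
  · have : ⌊x / 2 ^ N * 2 ^ (j + 1)⌋₊ = 0 := by
      rw [Nat.floor_eq_zero, div_mul_eq_mul_div, div_lt_one (by positivity)]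
      have h1 : (2 : ℝ) ^ (j + 1) ≤ 2 ^ N := pow_le_pow_right₀ (by norm_num) hj
      have h2 : (0 : ℝ) < 2 ^ (j + 1) := by positivity
      nlinarith [hx.2]
    simp [Real.digits, this]
  · rw [← hi]
    simp only [Real.digits]
    congr 2
    push_cast
    rw [show i + N + 1 = i + 1 + N by ring, pow_add _ (i + 1) N]
    field_simp

variable {E : Set UnitAddCircle}

theorem IsErdosSemigroup.div_two_pow_mem (hE : IsErdosSemigroup E) {x : ℝ}
    (hx : x ∈ circleToUnit E) (N : ℕ) : x / 2 ^ N ∈ circleToUnit E := by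
  obtain ⟨F, rfl, -, -, -, hsub⟩ := hE
  rcases Nat.eq_zero_or_pos N with rfl | hN
  · simpa using hx
  obtain ⟨i, hi⟩ := Set.mem_iUnion.1 hx.2
  have h1 : (1 : ℝ) ≤ 2 ^ N := one_le_pow₀ (by norm_num)
  have hy : x / 2 ^ N ∈ Set.Ico (0 : ℝ) 1 :=
    ⟨div_nonneg hx.1.1 (by positivity), (div_le_self hx.1.1 h1).trans_lt hx.1.2⟩
  have := hsub i x ⟨hx.1, hi⟩ _ hy (isBinarySubsequence_div_two_pow hx.1 hN)
  exact ⟨hy, Set.mem_iUnion.2 ⟨i, this.2⟩⟩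

theorem IsErdosSemigroup.add_mem (hE : IsErdosSemigroup E) {x y : ℝ}
    (hx : x ∈ circleToUnit E) (hy : y ∈ circleToUnit E) (hxy : x + y < 1) :
    x + y ∈ circleToUnit E := by
  obtain ⟨F, rfl, -, -, ⟨W, hW⟩, -⟩ := hE
  obtain ⟨i, hi⟩ := Set.mem_iUnion.1 hx.2
  obtain ⟨j, hj⟩ := Set.mem_iUnion.1 hy.2
  exact ⟨⟨add_nonneg hx.1.1 hy.1.1, hxy⟩,
    Set.mem_iUnion.2 ⟨W i j, hW i j (Set.add_mem_add hi hj)⟩⟩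

/-- Copies of x/2^N are added one by one; partial sums stay at most `x < 1`, so addition never wraps
around. -/
theorem IsErdosSemigroup.mul_div_two_pow_mem (hE : IsErdosSemigroup E) {x : ℝ}
    (hx : x ∈ circleToUnit E) (N m : ℕ) (hm : m + 1 ≤ 2 ^ N) :
    ((m + 1 : ℕ) : ℝ) * (x / 2 ^ N) ∈ circleToUnit E := by
  induction m with
  | zero => simpa using hE.div_two_pow_mem hx N
  | succ m ih =>
    rw [Nat.cast_succ, add_mul, one_mul]
    refine hE.add_mem (ih (by omega)) (hE.div_two_pow_mem hx N) ?_
    have h : ((m + 1 + 1 : ℕ) : ℝ) ≤ 2 ^ N := by exact_mod_cast hm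
    push_cast at h ⊢
    calc _ = (m + 1 + 1) * x / 2 ^ N := by ring
      _ ≤ x := by
        rw [div_le_iff₀ (by positivity), mul_comm]
        exact mul_le_mul_of_nonneg_left h hx.1.1
      _ < 1 := hx.1.2

/-- An Erdős semigroup of full dimension contains compact sets of dimension close to `1`. -/
theorem IsErdosSemigroup.exists_isCompact_subset (hE : IsErdosSemigroup E) {d : ENNReal}
    (hd : d < dimH (circleToUnit E)) :
    ∃ K ⊆ circleToUnit E, IsCompact K ∧ K ⊆ Set.Icc 0 (1 / 2) ∧ d < dimH K := by
  obtain ⟨F, rfl, hcl, -, -, hsub⟩ := hE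
  have hU : circleToUnit (⋃ i, F i) = ⋃ i, circleToUnit (F i) := by
    ext x
    simp [circleToUnit]
  rw [hU, dimH_iUnion] at hd
  obtain ⟨i, hi⟩ := lt_iSup_iff.1 hd
  have hcont : Continuous fun x : ℝ => (x : UnitAddCircle) := AddCircle.continuous_mk' 1
  refine ⟨Set.Icc 0 (1 / 2) ∩ (fun x : ℝ => (x : UnitAddCircle)) ⁻¹' F i, ?_,
    isCompact_Icc.inter_right ((hcl i).preimage hcont), Set.inter_subset_left, hi.trans_le ?_⟩
  · rintro x ⟨hx, hxF⟩
    exact ⟨⟨hx.1, by linarith [hx.2]⟩, Set.mem_iUnion.2 ⟨i, hxF⟩⟩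
  -- Doubling is Lipschitz and undoes the halving, so no dimension is lost.
  · have hlip : LipschitzWith 2 fun x : ℝ => 2 * x := by
      refine LipschitzWith.of_dist_le_mul fun x y => ?_
      rw [Real.dist_eq, Real.dist_eq, ← mul_sub, abs_mul]
      simp
    refine (dimH_mono ?_).trans (hlip.dimH_image_le _)
    intro x hx
    have hy : x / 2 ^ 1 ∈ Set.Ico (0 : ℝ) 1 := by
      constructor <;> linarith [hx.1.1, hx.1.2]
    refine ⟨x / 2 ^ 1, ⟨⟨hy.1, by linarith [hx.1.2]⟩, ?_⟩, by simp only; ring⟩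
    exact (hsub i x hx _ hy (isBinarySubsequence_div_two_pow hx.1 one_pos)).2

/-- The multiples `m 2⁻ᴺ [p, q]` with `2 m ≤ 2 ^ N` cover a right neighbourhood of `0`. -/
theorem exists_Ioc_subset_dyadic_multiples {p q : ℝ} (hp : 0 < p) (hpq : p < q) :
    ∃ b : ℝ, 0 < b ∧ ∀ t ∈ Set.Ioc 0 b, ∃ m N : ℕ, 2 * (m + 1) ≤ 2 ^ N ∧
      ∃ u ∈ Set.Icc p q, t = ((m + 1 : ℕ) : ℝ) * u / 2 ^ N := by
  -- This `k` makes (k+1)p ≤ kq, so the multiples of `[p, q]` overlap consecutively from the `k`-th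
  -- on.
  obtain ⟨k, hk⟩ := exists_nat_ge (p / (q - p))
  rw [div_le_iff₀ (by linarith)] at hk
  set A : ℝ := (k + 1) * p with hA
  have hA0 : 0 < A := by positivity
  obtain ⟨N₀, hN₀⟩ := pow_unbounded_of_one_lt ((4 * (k + 1) : ℕ) : ℝ) (one_lt_two (α := ℝ))
  refine ⟨A / 2 ^ N₀, by positivity, fun t ht => ?_⟩
  have hpow : (1 : ℝ) ≤ 2 ^ N₀ := one_le_pow₀ (by norm_num)
  have htA : t * 2 ^ N₀ ≤ A := (le_div_iff₀ (by positivity)).1 ht.2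
  have ht0 := ht.1
  -- `N` is chosen with A < 2^N t ≤ 2A. Then m + 1 ≤ 2(k+1), and the choice of `N₀` gives 2(m+1) ≤
  -- 2^N.
  obtain ⟨N, hN1, hN2⟩ := exists_nat_pow_near (x := 2 * A / t) (y := 2) (by
    rw [one_le_div ht0]
    nlinarith) one_lt_two
  rw [le_div_iff₀ ht0] at hN1
  rw [div_lt_iff₀ ht0, pow_succ] at hN2
  have hlow : A < 2 ^ N * t := by linarith
  have hNN : (2 : ℝ) ^ N₀ < 2 ^ N := by
    by_contra! h
    nlinarith
  have hfl1 : k + 1 ≤ ⌊2 ^ N * t / p⌋₊ := by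
    rw [Nat.le_floor_iff (by positivity), le_div_iff₀ hp]
    push_cast
    linarith
  obtain ⟨m, hm⟩ : ∃ m, ⌊2 ^ N * t / p⌋₊ = m + 1 := ⟨_, (Nat.sub_add_cancel (by omega)).symm⟩
  have hkm : k ≤ m := by omega
  obtain ⟨h1, h2⟩ := (Nat.floor_eq_iff (by positivity)).1 hm
  rw [le_div_iff₀ hp] at h1
  rw [div_lt_iff₀ hp] at h2
  push_cast at h1 h2
  refine ⟨m, N, ?_, 2 ^ N * t / (m + 1), ⟨?_, ?_⟩, ?_⟩
  · have h3 : (m : ℝ) + 1 ≤ 2 * (k + 1) := by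
      refine le_of_mul_le_mul_right (h1.trans (hN1.trans (le_of_eq ?_))) hp
      rw [hA]; ring
    have h4 : ((2 * (m + 1) : ℕ) : ℝ) ≤ ((2 ^ N : ℕ) : ℝ) := by
      push_cast at hN₀ ⊢
      linarith
    exact_mod_cast h4
  · rw [le_div_iff₀ (by positivity)]
    linarith
  · rw [div_le_iff₀ (by positivity)]
    have : (k : ℝ) ≤ m := by exact_mod_cast hkm
    nlinarith
  · push_cast
    field_simp

end ErdosSemigroup

/-! ### Conclusion -/

theorem theorem3p6 (E : Set UnitAddCircle) (hE : IsErdosSemigroup E)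
    (hdim : dimH (circleToUnit E) = 1) :
    ∃ b : ℝ, 0 < b ∧ IsBasisOfOrderTwo (circleToUnit E) (Set.Ioc 0 b) := by
  obtain ⟨K, hKE, hKc, hK01, hKd⟩ := hE.exists_isCompact_subset
    (d := ((3 / 4 : NNReal) : ENNReal)) (by
      rw [hdim, ← ENNReal.coe_one, ENNReal.coe_lt_coe, div_lt_one (by norm_num)]
      norm_num)
  obtain ⟨x, hxK, hpos⟩ := exists_mem_volume_add_smul_pos hKc hK01 hKd
  obtain ⟨c, η, hη, hsub⟩ := (hKc.add (hKc.smul x)).exists_Icc_subset_add hpos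
  have hx0 : 0 ≤ x := (hK01 hxK).1
  have hrep : ∀ u ∈ Set.Icc (c - η) (c + η), ∃ e₁ ∈ K, ∃ e₂ ∈ K, ∃ f₁ ∈ K, ∃ f₂ ∈ K,
      u = e₁ + e₂ + x * (f₁ + f₂) := by
    intro u hu
    obtain ⟨_, ⟨e₁, he₁, _, ⟨f₁, hf₁, rfl⟩, rfl⟩, _, ⟨e₂, he₂, _, ⟨f₂, hf₂, rfl⟩, rfl⟩, h⟩ :=
      hsub hu
    refine ⟨e₁, he₁, e₂, he₂, f₁, hf₁, f₂, hf₂, ?_⟩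
    simp only [smul_eq_mul] at h
    rw [← h]
    ring
  -- The left endpoint is a represented number, hence nonnegative. So `c > 0`, and the right half
  -- `[c, c + η]` can be dilated.
  have hc : η ≤ c := by
    obtain ⟨e₁, he₁, e₂, he₂, f₁, hf₁, f₂, hf₂, h⟩ := hrep (c - η) ⟨le_rfl, by linarith⟩
    have := mul_nonneg hx0 (add_nonneg (hK01 hf₁).1 (hK01 hf₂).1)
    linarith [(hK01 he₁).1, (hK01 he₂).1]
  obtain ⟨b, hb, hcov⟩ := exists_Ioc_subset_dyadic_multiples (p := c) (q := c + η)
    (by linarith) (by linarith)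
  refine ⟨b, hb, x, hKE hxK, fun t ht => ?_⟩
  obtain ⟨m, N, hmN, u, hu, rfl⟩ := hcov t ht
  obtain ⟨e₁, he₁, e₂, he₂, f₁, hf₁, f₂, hf₂, rfl⟩ := hrep u ⟨by linarith [hu.1], hu.2⟩
  -- Since g₁ + g₂ ≤ 1 and 2(m+1) ≤ 2^N, the sum is at most 1/2, so no wraparound occurs.
  have hsum : ∀ g₁ ∈ K, ∀ g₂ ∈ K,
      ((m + 1 : ℕ) : ℝ) * (g₁ / 2 ^ N) + ((m + 1 : ℕ) : ℝ) * (g₂ / 2 ^ N) ∈ circleToUnit E := by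
    intro g₁ h₁ g₂ h₂
    refine hE.add_mem (hE.mul_div_two_pow_mem (hKE h₁) N m (by omega))
      (hE.mul_div_two_pow_mem (hKE h₂) N m (by omega)) ?_
    have hmN' : 2 * ((m + 1 : ℕ) : ℝ) ≤ 2 ^ N := by exact_mod_cast hmN
    rw [← mul_add, ← add_div, mul_div_assoc', div_lt_one (by positivity)]
    have h3 : g₁ + g₂ ≤ 1 := by linarith [(hK01 h₁).2, (hK01 h₂).2]
    have h4 : (0 : ℝ) < ((m + 1 : ℕ) : ℝ) := by positivity
    nlinarith
  refine ⟨_, hsum e₁ he₁ e₂ he₂, _, ⟨_, hsum f₁ hf₁ f₂ hf₂, rfl⟩, ?_⟩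
  simp only [smul_eq_mul]
  ring
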